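/- A bidirected multigraph $B=(G,\sigma)$ is a finite loopless multigraph $G$ together with a sign $\sigma(v,e)\in\{+,-\}$ for every half-edge, i.e. for every pair of a vertex $v$ and an edge $e$ having $v$ as an endvertex. A path in $B$ is a path $v_0e_1v_1\dots e_\ell v_\ell$ in $G$ (with distinct vertices) such that $\sigma(v_i,e_i)\neq\sigma(v_i,e_{i+1})$ for all $1\le i\le \ell-1$. For $X\subseteq V(B)$, an $X$-path in $B$ is a path in $B$ with $\ell\ge 1$ whose endvertices $v_0,v_\ell$ lie in $X$ and none of whose other vertices lies in $X$. Paths are disjoint if they have no common vertex. For $Y\subseteq V(B)$, $B-Y$ is obtained from $B$ by deleting the vertices in $Y$ and all edges with an endvertex in $Y$, and restricting $\sigma$. **Theorem.** Let $k\ge 0$ be an integer. (1) For every bidirected multigraph $B$ and every $X\subseteq V(B)$, there exist $k$ pairwise disjoint $X$-paths in $B$, or there is a set $Y\subseteq V(B)$ with $|Y|\le 2k-2$ such that $B-Y$ contains no $X$-path. (2) The bound is tight: if $k\ge 1$, then there are a bidirected multigraph $B$ whose underlying multigraph is simple and a set $X\subseteq V(B)$ such that $B$ neither contains $k$ pairwise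 disjoint $X$-paths nor a set $Y\subseteq V(B)$ with $|Y|<2k-2$ for which $B-Y$ contains no $X$-path. -/

import Mathlib

/-- The two signs which an edge may carry at an endvertex. -/
inductive EdgeSign where
  | plus
  | minus

/-- A bidirected multigraph with vertices in `α` and edges in `β`: a multigraph without loops
together with a signing, which assigns a sign to every half-edge, that is, to every pair of a
vertex `v` and an edge `e` such that `v` is an endvertex of `e`. -/
structure BidirectedMultigraph (α β : Type*) where
  /-- The underlying multigraph. -/
  graph : Graph α β
  loopless : graph.Loopless
  /-- The signing. -/
  sign : ∀ (v : α) (e : β), graph.Inc e v → EdgeSign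

namespace BidirectedMultigraph

variable {α β : Type*}

/-- A bidirected multigraph is finite if it has finitely many vertices and edges. -/
def IsFinite (B : BidirectedMultigraph α β) : Prop :=
  B.graph.vertexSet.Finite ∧ B.graph.edgeSet.Finite

/-- `B - Y`: all vertices in `Y` are deleted, together with all edges that have an endvertex
in `Y`, and the signing is restricted to the remaining half-edges. -/
def deleteVerts (B : BidirectedMultigraph α β) (Y : Set α) : BidirectedMultigraph α β where
  graph := B.graph.deleteVerts Y
  loopless :=
    ⟨fun e x h => B.loopless.not_isLoopAt e x ((B.graph.deleteVerts_isLink Y).1 h).1⟩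
  sign v e h := B.sign v e (h.imp fun _ hw => ((B.graph.deleteVerts_isLink Y).1 hw).1)

/-- A path `v₀ e₁ v₁ … e_ℓ v_ℓ` in a bidirected multigraph: a path in the underlying multigraph
(the vertices are distinct) such that at each internal vertex the two half-edges of the path have
distinct signs. The edge `e_{i+1}`, which joins `v_i` to `v_{i+1}`, is `edge i` here. -/
structure Path (B : BidirectedMultigraph α β) where
  length : ℕ
  vert : Fin (length + 1) → α
  edge : Fin length → β
  vert_mem : ∀ i, vert i ∈ B.graph.vertexSet
  vert_injective : Function.Injective vert
  isLink : ∀ i : Fin length, B.graph.IsLink (edge i) (vert i.castSucc) (vert i.succ)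
  sign_ne : ∀ i j : Fin length, (j : ℕ) = i + 1 →
    B.sign (vert i.succ) (edge i) (isLink i).inc_right ≠
      B.sign (vert j.castSucc) (edge j) (isLink j).inc_left

/-- The set of vertices of a path. -/
def Path.verts {B : BidirectedMultigraph α β} (P : B.Path) : Set α := Set.range P.vert

/-- An `X`-path is a non-trivial path whose two endvertices lie in `X`, whereas `X` contains no
other vertex of the path. -/
def Path.IsXPath {B : BidirectedMultigraph α β} (P : B.Path) (X : Set α) : Prop :=
  0 < P.length ∧ P.vert 0 ∈ X ∧ P.vert (Fin.last P.length) ∈ X ∧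
    ∀ i, i ≠ 0 → i ≠ Fin.last P.length → P.vert i ∉ X

/-- `B` contains an `X`-path. -/
def HasXPath (B : BidirectedMultigraph α β) (X : Set α) : Prop :=
  ∃ P : B.Path, P.IsXPath X

/-- `B` contains `k` pairwise (vertex-)disjoint `X`-paths. -/
def HasDisjointXPaths (B : BidirectedMultigraph α β) (X : Set α) (k : ℕ) : Prop :=
  ∃ P : Fin k → B.Path, (∀ i, (P i).IsXPath X) ∧
    ∀ i j, i ≠ j → Disjoint (P i).verts (P j).verts

end BidirectedMultigraph

/-!
Part (1) is reduced to Tutte's theorem. Replace every vertex outside `X` by two ports, one for each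
sign, and every vertex in `X` by a single port. Each edge then joins two ports, and twin ports at a
vertex outside `X` are made adjacent as well. The twin pairs form a matching that leaves exactly the
ports in `X` uncovered, and its augmenting paths are precisely the `X`-paths: a path uses half-edges
of opposite signs at an internal vertex exactly if it runs through both ports there. If
`|X| < 2k`, deleting all but one vertex of `X` suffices. Otherwise add `d = |X| - 2k` vertices
adjacent to everything; this is the graph `auxGraph`, and the involution `auxPerm` swaps twins and
fixes the ports in `X` and the additional vertices.

If `auxGraph` has a perfect matching, superimpose it on the twin pairs. The components of the union
that contain a port in `X` or an additional vertex are alternating paths between two of these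
`|X| + d` vertices. There are `|X| - k` of them, at most `d` of which meet an additional vertex, so
at least `k` others yield disjoint `X`-paths (`hasDisjointXPaths_of_isPerfectMatching`). The
components appear as orbits of the group generated by two involutions
(`exists_disjoint_alternating_sequences`).

If there is no perfect matching, Tutte's theorem provides a set `U` whose removal leaves more than
`|U|` odd components, hence at least `|U| + 2` by parity. Call a port outside `U` a boundary port if
it is fixed by `auxPerm` or its twin lies in `U`. Delete the vertices of all twin pairs and fixed
ports within `U`, and of all boundary ports except for one in every odd component; such a port
exists because the other ports of the component are paired up by `auxPerm`. An `X`-path avoiding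
these vertices would start at a boundary port and would enter every further component, coming from
`U`, at a boundary port. It could never end, because its end would be a second boundary port of the
same component. Counting shows that at most `2k - 2` vertices are deleted (`exists_hitting_set`,
`exists_hitting_set_of_isTutteViolator`).

For part (2), the complete graph on `2k - 1` vertices with `X` the set of all vertices is tight: `k`
disjoint paths need `2k` ends, and any two remaining vertices are joined by an edge.
-/

/-! ### Orbits of the group generated by two involutions -/

section Involutions

variable {W : Type*} {τ m : Equiv.Perm W}

theorem involution_apply_zpow_mul (hτ : ∀ a, τ (τ a) = a) (hm : ∀ a, m (m a) = a) (t : ℤ) (z : W) :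
    τ (((τ * m) ^ t) z) = ((τ * m) ^ (-t)) (τ z) := by
  have h1 : τ * (τ * m) * τ⁻¹ = (τ * m)⁻¹ := by
    have hτ' : τ⁻¹ = τ := Equiv.ext fun a => by rw [Equiv.Perm.inv_eq_iff_eq, hτ]
    have hm' : m⁻¹ = m := Equiv.ext fun a => by rw [Equiv.Perm.inv_eq_iff_eq, hm]
    rw [mul_inv_rev, hm', hτ']
    exact Equiv.ext fun a => by simp [hτ]
  have h2 : τ * (τ * m) ^ t = (τ * m) ^ (-t) * τ := by
    rw [← mul_inv_eq_iff_eq_mul, ← conj_zpow, h1, inv_zpow, zpow_neg]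
  exact congrArg (fun σ : Equiv.Perm W => σ z) h2

/-- The orbit of a fixed point `z` of `τ` under `τ * m` has even length, because `m` maps
`(τ * m) ^ t` applied to `z` to `(τ * m) ^ (-t - 1)` applied to `z` and has no fixed points. -/
theorem exists_even_period [Finite W] (hτ : ∀ a, τ (τ a) = a) (hm : ∀ a, m (m a) = a)
    (hm' : ∀ a, m a ≠ a) {z : W} (hz : τ z = z) :
    ∃ n : ℕ, 0 < n ∧
      ∀ s t : ℤ, ((τ * m) ^ s) z = ((τ * m) ^ t) z ↔ (2 * n : ℤ) ∣ s - t := by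
  set p := Function.minimalPeriod (fun a => (τ * m) • a) z with hp
  have key (t : ℤ) : ((τ * m) ^ t) z = z ↔ (p : ℤ) ∣ t :=
    MulAction.zpow_smul_eq_iff_minimalPeriod_dvd (a := τ * m) (b := z) (n := t)
  have key2 (s t : ℤ) : ((τ * m) ^ s) z = ((τ * m) ^ t) z ↔ (p : ℤ) ∣ s - t := by
    rw [← key, show s - t = -t + s by ring, zpow_add, Equiv.Perm.mul_apply, zpow_neg,
      Equiv.Perm.inv_eq_iff_eq, eq_comm]
  have hpos : p ≠ 0 := by
    intro h0
    have h1 := (key (orderOf (τ * m))).1 (by rw [zpow_natCast, pow_orderOf_eq_one]; rfl)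
    rw [h0, Nat.cast_zero, zero_dvd_iff] at h1
    have := orderOf_pos (τ * m)
    omega
  have heven : Even p := by
    by_contra hodd
    obtain ⟨r, hr⟩ := Nat.not_even_iff_odd.1 hodd
    have h1 : ((τ * m) ^ ((r : ℤ) + 1)) z = ((τ * m) ^ (-(r : ℤ))) z := by
      rw [key2]
      exact ⟨1, by rw [hr]; push_cast; ring⟩
    have h2 : τ (((τ * m) ^ (r : ℤ)) z) = ((τ * m) ^ (-(r : ℤ))) z := by
      rw [involution_apply_zpow_mul hτ hm, hz]
    rw [← h2, add_comm, zpow_add, zpow_one, Equiv.Perm.mul_apply, Equiv.Perm.mul_apply] at h1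
    exact hm' _ (τ.injective h1)
  obtain ⟨n, hn⟩ := heven
  refine ⟨n, by omega, fun s t => ?_⟩
  rw [key2, hn]
  push_cast
  rw [two_mul]

/-- If `τ` and `m` are involutions and `m` has no fixed points, then every orbit of the group
generated by `τ` and `m` contains at most two fixed points of `τ`. Hence there are `k` orbits that
contain fixed points of `τ`, but none in a given small set `D`. Such an orbit
is traversed by alternate applications of `m` and `τ` from one fixed point to the other. -/
theorem exists_disjoint_alternating_sequences [Finite W] (hτ : ∀ a, τ (τ a) = a)
    (hm : ∀ a, m (m a) = a) (hm' : ∀ a, m a ≠ a) (D : Set W) (k : ℕ)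
    (hk : 2 * D.ncard + 2 * k ≤ {a | τ a = a}.ncard) :
    ∃ (n : Fin k → ℕ) (a : Fin k → ℕ → W),
      (∀ i, 0 < n i ∧ (τ (a i 0) = a i 0 ∧ a i 0 ∉ D) ∧
        (τ (a i (n i)) = a i (n i) ∧ a i (n i) ∉ D) ∧
        (∀ t, 0 < t → t < n i → τ (a i t) ≠ a i t) ∧
        (∀ t, m (a i t) = τ (a i (t + 1))) ∧
        (∀ s t, s < t → t ≤ n i → a i s ≠ a i t ∧ a i s ≠ τ (a i t))) ∧
      ∀ i j, i ≠ j → ∀ s t, a i s ≠ a j t ∧ a i s ≠ τ (a j t) := by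
  classical
  cases nonempty_fintype W
  set F : Finset W := {a | τ a = a} with hF
  have hFc : {a | τ a = a}.ncard = F.card := by
    rw [← Set.ncard_coe_finset]; simp [hF]
  let q : W → Set W := fun z => {w | (τ * m).SameCycle z w}
  have hq {z w : W} : q z = q w ↔ (τ * m).SameCycle z w := by
    refine ⟨fun h => ?_, fun h => ?_⟩
    · have : w ∈ q w := Equiv.Perm.SameCycle.refl _ _
      rw [← h] at this
      exact this
    · ext x
      exact ⟨fun hx => h.symm.trans hx, fun hx => h.trans hx⟩
  -- a fixed point of `τ` on the orbit of `z` is reached after a multiple of `n` steps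
  have hfib (z z' : W) (hz : τ z = z) (hz' : τ z' = z') (n : ℕ)
      (h : ∀ s t : ℤ, ((τ * m) ^ s) z = ((τ * m) ^ t) z ↔ (2 * n : ℤ) ∣ s - t)
      (hs : (τ * m).SameCycle z z') : z' = z ∨ z' = ((τ * m) ^ (n : ℤ)) z := by
    obtain ⟨t, rfl⟩ := hs
    rw [involution_apply_zpow_mul hτ hm, hz, h] at hz'
    have h0 : z = ((τ * m) ^ (0 : ℤ)) z := rfl
    have : (n : ℤ) ∣ t := by
      obtain ⟨c, hc⟩ := hz'
      exact ⟨-c, by linarith⟩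
    obtain ⟨c, rfl⟩ := this
    obtain ⟨d, rfl | rfl⟩ := Int.even_or_odd' c
    · left
      conv_rhs => rw [h0]
      rw [h]
      exact ⟨d, by ring⟩
    · right
      rw [h]
      exact ⟨d, by ring⟩
  have hcard : F.card ≤ 2 * (F.image q).card := by
    refine Finset.card_le_mul_card_image _ _ fun b hb => ?_
    obtain ⟨z, hz, rfl⟩ := Finset.mem_image.1 hb
    have hz : τ z = z := by simpa [hF] using hz
    obtain ⟨n, -, h⟩ := exists_even_period hτ hm hm' hz
    refine (Finset.card_le_card (t := {z, ((τ * m) ^ (n : ℤ)) z}) fun w hw => ?_).trans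
      Finset.card_le_two
    simp only [hF, Finset.mem_filter, Finset.mem_univ, true_and] at hw
    simpa using hfib z w hz hw.1 n h (hq.1 hw.2.symm)
  have hcard2 : k ≤ (F.image q \ D.toFinset.image q).card := by
    have h1 := Finset.le_card_sdiff (D.toFinset.image q) (F.image q)
    have h2 : (D.toFinset.image q).card ≤ D.ncard := by
      rw [Set.ncard_eq_toFinset_card']
      exact Finset.card_image_le
    omega
  obtain ⟨T, hT, hTk⟩ := Finset.exists_subset_card_eq hcard2
  let e : Fin k ≃ T := (T.equivFinOfCardEq hTk).symm
  have hz (i : Fin k) : ∃ z, τ z = z ∧ q z = e i ∧ q z ∉ D.toFinset.image q := by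
    have := hT (e i).2
    rw [Finset.mem_sdiff, Finset.mem_image] at this
    obtain ⟨⟨z, hz, hzi⟩, hD⟩ := this
    exact ⟨z, by simpa [hF] using hz, hzi, by rwa [hzi]⟩
  choose z hz hze hzD using hz
  choose n hn hper using fun i => exists_even_period hτ hm hm' (hz i)
  have hτa (i : Fin k) (t : ℤ) : τ (((τ * m) ^ t) (z i)) = ((τ * m) ^ (-t)) (z i) := by
    rw [involution_apply_zpow_mul hτ hm, hz]
  have hD (i : Fin k) (t : ℤ) : ((τ * m) ^ t) (z i) ∉ D := by
    intro h
    refine hzD i (Finset.mem_image.2 ⟨_, by simpa using h, hq.2 ?_⟩)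
    exact Equiv.Perm.SameCycle.symm ⟨t, rfl⟩
  refine ⟨n, fun i t => ((τ * m) ^ (t : ℤ)) (z i), fun i => ⟨hn i, ⟨by simpa using hz i, hD i _⟩,
    ⟨?_, hD i _⟩, fun t ht0 htn h => ?_, fun t => ?_, fun s t hst htn => ⟨fun h => ?_, fun h => ?_⟩⟩,
    fun i j hij s t => ⟨fun h => hij ?_, fun h => hij ?_⟩⟩
  · rw [hτa, hper]
    exact ⟨-1, by ring⟩
  · rw [hτa, hper] at h
    obtain ⟨c, hc⟩ := h
    have : (n i : ℤ) ∣ t := ⟨-c, by linarith⟩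
    exact absurd (Nat.le_of_dvd ht0 (Int.natCast_dvd_natCast.1 this)) (by omega)
  · push_cast
    rw [add_comm, zpow_add, zpow_one, Equiv.Perm.mul_apply, Equiv.Perm.mul_apply, hτ]
  · rw [hper, dvd_sub_comm] at h
    have := Int.le_of_dvd (by omega) h
    omega
  · rw [hτa, hper] at h
    have := Int.le_of_dvd (by omega) h
    omega
  · refine e.injective (Subtype.ext ?_)
    rw [← hze, ← hze, hq]
    refine (Equiv.Perm.SameCycle.trans ⟨s, h⟩ (Equiv.Perm.SameCycle.symm ⟨t, rfl⟩))
  · refine e.injective (Subtype.ext ?_)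
    rw [hτa] at h
    rw [← hze, ← hze, hq]
    refine (Equiv.Perm.SameCycle.trans ⟨s, h⟩ (Equiv.Perm.SameCycle.symm ⟨-t, rfl⟩))

end Involutions

/-! ### Hitting alternating sequences by means of a Tutte violator -/

section Hitting

variable {W : Type*}

theorem even_ncard_of_involution {τ : W → W} {s : Set W} (hs : s.Finite)
    (hτ : ∀ a, τ (τ a) = a) (hfix : ∀ a ∈ s, τ a ≠ a) (hmem : ∀ a ∈ s, τ a ∈ s) :
    Even s.ncard := by
  classical
  lift s to Finset W using hs
  rw [Set.ncard_coe_finset, ← ZMod.natCast_eq_zero_iff_even, Finset.cast_card]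
  exact Finset.sum_involution (fun a _ => τ a) (fun a _ => by decide)
    (fun a ha _ => hfix a ha) (fun a ha => hmem a ha) (fun a _ => hτ a)

/-- If `G` has a set `U` such that `G - U` has at least `|U| + 2` odd components, then a set of at
most `|F \ U| - 2` vertices meets every `G`-alternating sequence between two fixed points of `τ`,
where `F` is the set of fixed points. It consists of the pairs `{a, τ a}` inside `U` and of all but
at most one of the boundary vertices of each component, where a vertex
outside `U` is a boundary vertex if it is fixed by `τ` or mapped into `U`; in an odd component there
is a boundary vertex because the other vertices are paired up by `τ`. -/
theorem exists_hitting_set [Finite W] {G : SimpleGraph W} {τ : W → W} (hτ : ∀ a, τ (τ a) = a)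
    (hG : ∀ a, τ a ≠ a → G.Adj a (τ a)) (U : Set W)
    (hU : U.ncard + 2 ≤ ((⊤ : G.Subgraph).deleteVerts U).coe.oddComponents.ncard) :
    ∃ Z : Set W, Z.ncard + 2 ≤ ({a | τ a = a} \ U).ncard ∧
      (∀ a ∈ U, τ a ∈ U → a ∈ Z) ∧
      ∀ (n : ℕ) (a : ℕ → W), τ (a 0) = a 0 → τ (a n) = a n → 0 < n →
        (∀ i < n, G.Adj (a i) (τ (a (i + 1)))) →
        (∀ i < n, ∀ j ≤ i, τ (a (i + 1)) ≠ a j) →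
        ∃ i ≤ n, a i ∈ Z ∨ τ (a i) ∈ Z := by
  classical
  set K := ((⊤ : G.Subgraph).deleteVerts U).coe with hK
  have hv (a : W) : a ∈ ((⊤ : G.Subgraph).deleteVerts U).verts ↔ a ∉ U := by simp
  have hadj {a b : W} (ha : a ∉ U) (hb : b ∉ U) (h : G.Adj a b) :
      K.Adj ⟨a, (hv a).2 ha⟩ ⟨b, (hv b).2 hb⟩ := by
    simp [hK, ha, hb, h]
  set Bd : Set W := {a | a ∉ U ∧ (τ a = a ∨ τ a ∈ U)} with hBd
  -- every odd component has a boundary vertex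
  have hrep (C : K.oddComponents) : ∃ a, ∃ ha : a ∉ U, a ∈ Bd ∧
      K.connectedComponentMk ⟨a, (hv a).2 ha⟩ = C.1 := by
    by_contra! hcon
    have hC : Odd (C.1.supp.ncard) := C.2
    have himg : ((Subtype.val '' C.1.supp : Set W)).ncard = C.1.supp.ncard :=
      Set.ncard_image_of_injective _ Subtype.val_injective
    rw [← himg] at hC
    refine Nat.not_even_iff_odd.2 hC (even_ncard_of_involution (Set.toFinite _) hτ ?_ ?_)
    · rintro _ ⟨⟨a, ha⟩, haC, rfl⟩ hfix
      exact hcon a ((hv a).1 ha) ⟨(hv a).1 ha, .inl hfix⟩ haC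
    · rintro _ ⟨⟨a, ha⟩, haC, rfl⟩
      have haU := (hv a).1 ha
      have hb : a ∉ Bd := fun h => hcon a haU h haC
      have h1 : τ a ≠ a := fun h => hb ⟨haU, .inl h⟩
      have h2 : τ a ∉ U := fun h => hb ⟨haU, .inr h⟩
      refine ⟨⟨τ a, (hv _).2 h2⟩, ?_, rfl⟩
      rw [SimpleGraph.ConnectedComponent.mem_supp_iff] at haC ⊢
      rw [← haC]
      exact SimpleGraph.ConnectedComponent.sound (hadj haU h2 (hG a h1)).reachable.symm
  choose r hrU hrB hrC using hrep
  have hrinj : Function.Injective r := fun C C' h => by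
    refine Subtype.ext ?_
    rw [← hrC, ← hrC]
    congr 2
  set R : Set W := Set.range r with hR
  have hRc : R.ncard = K.oddComponents.ncard := by
    rw [hR, ← Set.image_univ, Set.ncard_image_of_injective _ hrinj, Set.ncard_univ,
      Nat.card_coe_set_eq]
  -- two representatives in the same component agree
  have hRuniq {a b : W} (ha : a ∈ R) (hb : b ∈ R) (haU : a ∉ U) (hbU : b ∉ U)
      (h : K.Reachable ⟨a, (hv a).2 haU⟩ ⟨b, (hv b).2 hbU⟩) : a = b := by
    obtain ⟨C, rfl⟩ := ha
    obtain ⟨C', rfl⟩ := hb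
    have := SimpleGraph.ConnectedComponent.sound h
    rw [hrC, hrC] at this
    rw [Subtype.ext this]
  set U₂ : Set W := {a | a ∈ U ∧ τ a ∈ U} with hU₂
  set U₁ : Set W := {a | a ∈ U ∧ τ a ∉ U} with hU₁
  have hRBd : R ⊆ Bd := by rintro _ ⟨C, rfl⟩; exact hrB C
  refine ⟨(Bd \ R) ∪ U₂, ?_, fun a h1 h2 => .inr ⟨h1, h2⟩, ?_⟩
  · have h1 : U.ncard = U₁.ncard + U₂.ncard := by
      rw [← Set.ncard_union_eq]
      · congr 1
        ext a
        simp only [hU₁, hU₂, Set.mem_union, Set.mem_ofPred_eq]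
        tauto
      · exact Set.disjoint_left.2 fun a h h' => h.2 h'.2
    have h2 : Bd.ncard ≤ ({a | τ a = a} \ U).ncard + U₁.ncard := by
      have : Bd ⊆ ({a | τ a = a} \ U) ∪ τ '' U₁ := by
        rintro a ⟨haU, ha | ha⟩
        · exact .inl ⟨ha, haU⟩
        · exact .inr ⟨τ a, ⟨ha, by rwa [hτ]⟩, hτ a⟩
      refine (Set.ncard_le_ncard this).trans ((Set.ncard_union_le _ _).trans ?_)
      refine Nat.add_le_add_left ?_ _
      exact Set.ncard_image_le (s := U₁) (Set.toFinite _)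
    have h3 := Set.ncard_sdiff_add_ncard_of_subset hRBd
    have h4 := Set.ncard_union_le (Bd \ R) U₂
    omega
  · intro n a h0 hn hpos hstep hne
    by_contra! hZ
    have hZB {b : W} (hb : b ∈ Bd) (hbZ : b ∉ (Bd \ R) ∪ U₂) : b ∈ R := by
      by_contra h
      exact hbZ (.inl ⟨hb, h⟩)
    -- The sequence stays outside `U`, and the component of its current member has its
    -- representative among the members visited so far.
    have inv : ∀ i ≤ n, ∃ hi : a i ∉ U, ∃ j ≤ i, ∃ hj : a j ∉ U, a j ∈ R ∧
        K.Reachable ⟨a j, (hv _).2 hj⟩ ⟨a i, (hv _).2 hi⟩ := by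
      intro i
      induction i with
      | zero =>
        intro _
        have hU0 : a 0 ∉ U := fun h => (hZ 0 (by omega)).1 (.inr ⟨h, by rwa [h0]⟩)
        exact ⟨hU0, 0, le_rfl, hU0, hZB ⟨hU0, .inl h0⟩ (hZ 0 (by omega)).1,
          SimpleGraph.Reachable.refl _⟩
      | succ i ih =>
        intro hi
        obtain ⟨hiU, j, hji, hjU, hjR, hjr⟩ := ih (by omega)
        obtain ⟨hZ1, hZ2⟩ := hZ (i + 1) hi
        by_cases hb : τ (a (i + 1)) ∈ U
        · have hU1 : a (i + 1) ∉ U := fun h => hZ1 (.inr ⟨h, hb⟩)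
          exact ⟨hU1, i + 1, le_rfl, hU1, hZB ⟨hU1, .inr hb⟩ hZ1, SimpleGraph.Reachable.refl _⟩
        · have hr := hjr.trans (hadj hiU hb (hstep i (by omega))).reachable
          have hnB : τ (a (i + 1)) ∉ Bd := fun h =>
            hne i (by omega) j hji (hRuniq hjR (hZB h hZ2) hjU hb hr).symm
          have hU1 : a (i + 1) ∉ U := fun h => hnB ⟨hb, .inr (by rwa [hτ])⟩
          have hfix : τ (τ (a (i + 1))) ≠ τ (a (i + 1)) := fun h => hnB ⟨hb, .inl h⟩
          have h3 := hG _ hfix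
          rw [hτ] at h3
          exact ⟨hU1, j, by omega, hjU, hjR, hr.trans (hadj hb hU1 h3).reachable⟩
    obtain ⟨i, rfl⟩ : ∃ i, n = i + 1 := ⟨n - 1, by omega⟩
    obtain ⟨hiU, j, hji, hjU, hjR, hjr⟩ := inv i (by omega)
    obtain ⟨hU1, -⟩ := inv (i + 1) le_rfl
    have hst := hstep i (by omega)
    rw [hn] at hst
    have hr := hjr.trans (hadj hiU hU1 hst).reachable
    have := hRuniq hjR (hZB ⟨hU1, .inl hn⟩ (hZ (i + 1) le_rfl).1) hjU hU1 hr
    exact hne i (by omega) j hji (by rw [hn, this])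

end Hitting

/-! ### Opposite signs -/

/-- The opposite sign. -/
def EdgeSign.flip : EdgeSign → EdgeSign
  | .plus => .minus
  | .minus => .plus

theorem EdgeSign.flip_flip (s : EdgeSign) : s.flip.flip = s := by cases s <;> rfl

theorem EdgeSign.flip_ne (s : EdgeSign) : s.flip ≠ s := by
  cases s <;> exact EdgeSign.noConfusion

theorem EdgeSign.eq_flip_of_ne {s t : EdgeSign} (h : s ≠ t) : s = t.flip := by
  cases s <;> cases t <;> first | rfl | exact absurd rfl h

instance : Finite EdgeSign :=
  Finite.of_surjective (fun b : Bool => if b then EdgeSign.plus else EdgeSign.minus) fun s => by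
    cases s
    · exact ⟨true, rfl⟩
    · exact ⟨false, rfl⟩

namespace BidirectedMultigraph

variable {α β : Type*}

/-! ### The tight example -/

/-- The complete graph on `n` vertices, all of whose half-edges are positive. -/
def positiveComplete (n : ℕ) : BidirectedMultigraph (Fin n) (Sym2 (Fin n)) where
  graph := Graph.ofSimpleGraph ⊤
  loopless := ⟨fun e x h => by
    rw [← Graph.isLink_self_iff, Graph.ofSimpleGraph_isLink] at h
    simp [h.1] at h⟩
  sign _ _ _ := EdgeSign.plus

theorem positiveComplete_isLink {n : ℕ} {x y : Fin n} (h : x ≠ y) :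
    (positiveComplete n).graph.IsLink s(x, y) x y := by
  simp [positiveComplete, h]

theorem positiveComplete_simple (n : ℕ) : (positiveComplete n).graph.Simple where
  not_isLoopAt := (positiveComplete n).loopless.not_isLoopAt
  eq_of_isLink e f x y he hf := by
    simp only [positiveComplete, Graph.ofSimpleGraph_isLink] at he hf
    rw [he.1, hf.1]

theorem Path.IsXPath.vert_zero_ne_vert_last {B : BidirectedMultigraph α β} {X : Set α} {P : B.Path}
    (hP : P.IsXPath X) : P.vert 0 ≠ P.vert (Fin.last P.length) := fun h => by
  have := congrArg Fin.val (P.vert_injective h)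
  have := hP.1
  simp at *
  omega

/-- Each of the paths occupies two vertices, its ends, of `X`. -/
theorem HasDisjointXPaths.two_mul_le_ncard {B : BidirectedMultigraph α β} {X : Set α} {k : ℕ}
    (h : B.HasDisjointXPaths X k) (hX : X.Finite) : 2 * k ≤ X.ncard := by
  obtain ⟨P, hP, hdisj⟩ := h
  have : Finite X := hX
  let f : Fin k × Bool → X := fun p =>
    if p.2 then ⟨(P p.1).vert 0, (hP p.1).2.1⟩ else ⟨(P p.1).vert (Fin.last _), (hP p.1).2.2.1⟩
  have hfm (p) : (f p : α) ∈ (P p.1).verts := by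
    unfold f
    split_ifs
    · exact ⟨_, rfl⟩
    · exact ⟨_, rfl⟩
  have hf : Function.Injective f := by
    rintro ⟨i, b⟩ ⟨j, c⟩ h
    obtain rfl : i = j := by
      by_contra hij
      exact Set.disjoint_left.1 (hdisj i j hij) (hfm (i, b)) (h ▸ hfm (j, c))
    have hne := (hP i).vert_zero_ne_vert_last
    cases b <;> cases c
    · rfl
    · exact absurd (congrArg Subtype.val h).symm hne
    · exact absurd (congrArg Subtype.val h) hne
    · rfl
  have := Nat.card_le_card_of_injective f hf
  rw [Nat.card_coe_set_eq] at this
  simp at this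
  omega

/-- An edge with both ends in `X` gives an `X`-path. -/
theorem hasXPath_of_isLink {B : BidirectedMultigraph α β} {X : Set α} {e : β} {x y : α}
    (h : B.graph.IsLink e x y) (hne : x ≠ y) (hx : x ∈ X) (hy : y ∈ X) : B.HasXPath X := by
  let P : B.Path := ⟨1, ![x, y], ![e], ?_, ?_, ?_, ?_⟩
  · refine ⟨P, Nat.one_pos, hx, hy, fun (i : Fin 2) h0 h1 => ?_⟩
    fin_cases i
    · exact absurd rfl h0
    · exact absurd rfl h1
  · intro i
    fin_cases i
    · exact h.left_mem
    · exact h.right_mem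
  · intro i j hij
    fin_cases i <;> fin_cases j <;> simp_all
  · intro i
    fin_cases i
    exact h
  · intro i j hij
    omega

theorem positiveComplete_hasXPath {n : ℕ} (Y : Finset (Fin n)) (hY : Y.card + 2 ≤ n) :
    ((positiveComplete n).deleteVerts Y).HasXPath Set.univ := by
  have h : 1 < Yᶜ.card := by
    rw [Finset.card_compl, Fintype.card_fin]
    omega
  obtain ⟨x, hx, y, hy, hxy⟩ := Finset.one_lt_card.1 h
  refine hasXPath_of_isLink (e := s(x, y)) (x := x) (y := y) ?_ hxy trivial trivial
  exact (Graph.deleteVerts_isLink _ _).2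
    ⟨positiveComplete_isLink hxy, by simpa using hx, by simpa using hy⟩

theorem exists_tight_example {k : ℕ} (hk : 1 ≤ k) :
    ∃ (α : Type) (β : Type) (B : BidirectedMultigraph α β) (X : Set α),
      B.IsFinite ∧ B.graph.Simple ∧ X ⊆ B.graph.vertexSet ∧
      ¬ B.HasDisjointXPaths X k ∧
      ¬ ∃ Y : Finset α, (Y : Set α) ⊆ B.graph.vertexSet ∧ (Y.card : ℤ) < 2 * (k : ℤ) - 2 ∧
          ¬ (B.deleteVerts Y).HasXPath X := by
  refine ⟨_, _, positiveComplete (2 * k - 1), Set.univ, ⟨Set.toFinite _, Set.toFinite _⟩,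
    positiveComplete_simple _, fun _ _ => trivial, fun h => ?_, ?_⟩
  · have := h.two_mul_le_ncard (Set.toFinite _)
    rw [Set.ncard_univ, Nat.card_eq_fintype_card, Fintype.card_fin] at this
    omega
  · rintro ⟨Y, -, hY, h⟩
    exact h (positiveComplete_hasXPath Y (by omega))

/-! ### The ports of a bidirected multigraph -/

/-- A vertex outside `X` has one port for each sign. A vertex in `X` has a single port, which serves
its half-edges of both signs and is encoded by the sign `plus`. -/
def Port (B : BidirectedMultigraph α β) (X : Set α) : Type _ :=
  {p : α × EdgeSign // p.1 ∈ B.graph.vertexSet ∧ (p.1 ∈ X → p.2 = .plus)}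

variable {B : BidirectedMultigraph α β} {X : Set α}

open Classical in
/-- The port at `v` that serves the half-edges with sign `s`. -/
noncomputable def port (X : Set α) {v : α} (hv : v ∈ B.graph.vertexSet) (s : EdgeSign) :
    B.Port X :=
  ⟨(v, if v ∈ X then .plus else s), hv, fun h => if_pos h⟩

namespace Port

/-- The vertex to which a port belongs. -/
def vertex (p : B.Port X) : α := p.1.1

/-- The sign of a port; it is a mere convention at the vertices in `X`. -/
def sign (p : B.Port X) : EdgeSign := p.1.2

theorem vertex_mem (p : B.Port X) : p.vertex ∈ B.graph.vertexSet := p.2.1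

theorem ext' {p q : B.Port X} (hv : p.vertex = q.vertex) (h : p.vertex ∉ X → p.sign = q.sign) :
    p = q := by
  refine Subtype.ext (Prod.ext hv ?_)
  by_cases hp : p.vertex ∈ X
  · exact (p.2.2 hp).trans (q.2.2 (show q.vertex ∈ X from hv ▸ hp)).symm
  · exact h hp

/-- The other port at the same vertex; at a vertex in `X` this is the given port itself. -/
noncomputable def twin (p : B.Port X) : B.Port X := port X p.vertex_mem p.sign.flip

@[simp] theorem vertex_twin (p : B.Port X) : p.twin.vertex = p.vertex := rfl

theorem sign_twin {p : B.Port X} (h : p.vertex ∉ X) : p.twin.sign = p.sign.flip := if_neg h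

theorem twin_twin (p : B.Port X) : p.twin.twin = p :=
  ext' rfl fun h => by
    rw [vertex_twin, vertex_twin] at h
    rw [sign_twin (p := p.twin) h, sign_twin h, EdgeSign.flip_flip]

theorem twin_eq_self_iff {p : B.Port X} : p.twin = p ↔ p.vertex ∈ X := by
  refine ⟨fun h => ?_, fun h => ext' rfl fun h' => absurd h h'⟩
  by_contra hp
  exact p.sign.flip_ne (by rw [← sign_twin hp, h])

theorem eq_or_eq_twin {p q : B.Port X} (h : p.vertex = q.vertex) : p = q ∨ p = q.twin := by
  by_cases hs : p.sign = q.sign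
  · exact .inl (ext' h fun _ => hs)
  · exact .inr (ext' h fun hp => by
      rw [sign_twin (h ▸ hp)]
      exact EdgeSign.eq_flip_of_ne hs)

/-- Two ports are linked if they are the ports of the two half-edges of some edge. -/
def Linked (p q : B.Port X) : Prop :=
  ∃ (e : β) (h : B.graph.IsLink e p.vertex q.vertex),
    (p.vertex ∉ X → B.sign p.vertex e h.inc_left = p.sign) ∧
    (q.vertex ∉ X → B.sign q.vertex e h.inc_right = q.sign)

theorem Linked.symm {p q : B.Port X} (h : p.Linked q) : q.Linked p := by
  obtain ⟨e, h, hp, hq⟩ := h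
  exact ⟨e, h.symm, hq, hp⟩

theorem finite (hB : B.IsFinite) : Finite (B.Port X) := by
  have : Finite B.graph.vertexSet := hB.1
  refine Finite.of_injective
    (fun p : B.Port X => ((⟨p.vertex, p.vertex_mem⟩, p.sign) : B.graph.vertexSet × EdgeSign)) ?_
  intro p q h
  rw [Prod.mk.injEq, Subtype.mk.injEq] at h
  exact ext' h.1 fun _ => h.2

theorem ncard_vertex_mem (hX : X ⊆ B.graph.vertexSet) :
    {p : B.Port X | p.vertex ∈ X}.ncard = X.ncard := by
  refine Set.ncard_congr (fun p _ => p.vertex) (fun p hp => hp)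
    (fun p q hp _ h => ext' h fun h' => absurd hp h') fun x hx => ⟨port X (hX hx) .plus, hx, rfl⟩

end Port

/-! ### Translation between `X`-paths and alternating sequences of ports -/

/-- The port `p i` is the one by which the path leaves its vertex `i`, so that the path enters this
vertex by the twin of `p i`. At the two ends, which lie in `X`, the twin is `p i` itself. -/
theorem exists_isXPath_of_ports {n : ℕ} (p : Fin (n + 1) → B.Port X)
    (hinj : Function.Injective fun i => (p i).vertex)
    (hlink : ∀ i : Fin n, (p i.castSucc).Linked (p i.succ).twin) (hn : 0 < n)
    (h0 : (p 0).vertex ∈ X) (hlast : (p (Fin.last n)).vertex ∈ X)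
    (hint : ∀ i, i ≠ 0 → i ≠ Fin.last n → (p i).vertex ∉ X) :
    ∃ P : B.Path, P.IsXPath X ∧ P.verts = Set.range fun i => (p i).vertex := by
  choose e he hl hr using hlink
  refine ⟨⟨n, fun i => (p i).vertex, e, fun i => (p i).vertex_mem, hinj, he, fun i j hij => ?_⟩,
    ⟨hn, h0, hlast, hint⟩, rfl⟩
  have hji : j.castSucc = i.succ := Fin.ext hij
  have hX : (p i.succ).vertex ∉ X := by
    refine hint _ (Fin.succ_ne_zero i) ?_
    rw [← hji]
    exact (Fin.castSucc_lt_last j).ne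
  have h1 := hr i hX
  rw [Port.sign_twin hX] at h1
  have h2 := hl j (by rwa [hji])
  have h3 : (p j.castSucc).sign = (p i.succ).sign := by rw [hji]
  intro h
  exact (p i.succ).sign.flip_ne (h1.symm.trans (h.trans (h2.trans h3)))

/-- The converse of `exists_isXPath_of_ports`. -/
theorem Path.IsXPath.exists_ports {P : B.Path} (hP : P.IsXPath X) :
    ∃ p : Fin (P.length + 1) → B.Port X, (∀ i, (p i).vertex = P.vert i) ∧
      ∀ i : Fin P.length, (p i.castSucc).Linked (p i.succ).twin := by
  set s : Fin (P.length + 1) → EdgeSign :=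
    Fin.snoc (fun i => B.sign (P.vert i.castSucc) (P.edge i) (P.isLink i).inc_left) .plus with hs
  refine ⟨fun i => port X (P.vert_mem i) (s i), fun i => rfl, fun i => ⟨P.edge i, P.isLink i,
    fun h => ?_, fun h => ?_⟩⟩
  · have : (port X (P.vert_mem i.castSucc) (s i.castSucc)).sign = s i.castSucc := if_neg h
    rw [this, hs, Fin.snoc_castSucc]
    rfl
  · have h' : P.vert i.succ ∉ X := h
    have h1 : (port X (P.vert_mem i.succ) (s i.succ)).sign = s i.succ := if_neg h'
    have h3 : (port X (P.vert_mem i.succ) (s i.succ)).twin.sign = (s i.succ).flip :=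
      (Port.sign_twin h').trans (congrArg EdgeSign.flip h1)
    refine (EdgeSign.eq_flip_of_ne ?_).trans h3.symm
    change B.sign (P.vert i.succ) (P.edge i) (P.isLink i).inc_right ≠ s i.succ
    have hlast : i.succ ≠ Fin.last _ := fun h2 => h' (h2 ▸ hP.2.2.1)
    obtain ⟨j, hj⟩ := Fin.exists_castSucc_eq.2 hlast
    have h2 : s i.succ = B.sign (P.vert j.castSucc) (P.edge j) (P.isLink j).inc_left := by
      rw [← hj, hs, Fin.snoc_castSucc]
    rw [h2]
    exact P.sign_ne i j (congrArg Fin.val hj)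

theorem exists_isXPath_disjoint_of_deleteVerts {Y : Set α}
    (h : (B.deleteVerts Y).HasXPath X) : ∃ P : B.Path, P.IsXPath X ∧ Disjoint P.verts Y := by
  obtain ⟨P, hP⟩ := h
  have hv (i) : P.vert i ∈ B.graph.vertexSet \ Y :=
    Graph.vertexSet_deleteVerts B.graph Y ▸ P.vert_mem i
  refine ⟨⟨P.length, P.vert, P.edge, fun i => (hv i).1, P.vert_injective,
    fun i => ((Graph.deleteVerts_isLink _ _).1 (P.isLink i)).1, P.sign_ne⟩, hP, ?_⟩
  rw [Set.disjoint_left]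
  rintro _ ⟨i, rfl⟩
  exact (hv i).2

/-! ### The auxiliary graph -/

/-- The relation that generates the auxiliary graph: linked ports, twins, and every pair of which at
least one member is an additional vertex. -/
def auxRel (B : BidirectedMultigraph α β) (X : Set α) (d : ℕ) :
    B.Port X ⊕ Fin d → B.Port X ⊕ Fin d → Prop
  | .inl p, .inl q => p.Linked q ∨ q = p.twin
  | _, _ => True

/-- The graph on the ports in which linked ports and twins are adjacent, together with `d` additional
vertices that are adjacent to all other vertices. -/
def auxGraph (B : BidirectedMultigraph α β) (X : Set α) (d : ℕ) :
    SimpleGraph (B.Port X ⊕ Fin d) :=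
  SimpleGraph.fromRel (auxRel B X d)

/-- The involution that exchanges twins and fixes the additional vertices. -/
noncomputable def auxPerm (B : BidirectedMultigraph α β) (X : Set α) (d : ℕ) :
    Equiv.Perm (B.Port X ⊕ Fin d) :=
  Function.Involutive.toPerm (Sum.map Port.twin id) (by
    rintro (p | i)
    · exact congrArg Sum.inl p.twin_twin
    · rfl)

variable {d k : ℕ}

@[simp] theorem auxPerm_inl (p : B.Port X) : auxPerm B X d (.inl p) = .inl p.twin := rfl

@[simp] theorem auxPerm_inr (i : Fin d) : auxPerm B X d (.inr i) = .inr i := rfl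

theorem auxPerm_auxPerm (a : B.Port X ⊕ Fin d) : auxPerm B X d (auxPerm B X d a) = a :=
  (auxPerm B X d).left_inv a

theorem auxGraph_adj_inl {p q : B.Port X} :
    (auxGraph B X d).Adj (.inl p) (.inl q) ↔ p ≠ q ∧ (p.Linked q ∨ q = p.twin) := by
  rw [auxGraph, SimpleGraph.fromRel_adj]
  simp only [auxRel, ne_eq, Sum.inl.injEq]
  refine and_congr_right fun _ => ⟨?_, .inl⟩
  rintro (h | h | rfl)
  · exact h
  · exact .inl h.symm
  · exact .inr q.twin_twin.symm

theorem auxGraph_adj_inr {a : B.Port X ⊕ Fin d} {i : Fin d} (h : a ≠ .inr i) :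
    (auxGraph B X d).Adj a (.inr i) := by
  rw [auxGraph, SimpleGraph.fromRel_adj]
  exact ⟨h, .inl (by cases a <;> trivial)⟩

theorem auxGraph_adj_auxPerm {a : B.Port X ⊕ Fin d} (h : auxPerm B X d a ≠ a) :
    (auxGraph B X d).Adj a (auxPerm B X d a) := by
  obtain p | i := a
  · exact auxGraph_adj_inl.2 ⟨fun h' => h (congrArg Sum.inl h'.symm), .inr rfl⟩
  · exact absurd rfl h

theorem setOf_auxPerm_eq_self :
    {a | auxPerm B X d a = a} = Sum.inl '' {p : B.Port X | p.vertex ∈ X} ∪ Set.range Sum.inr := by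
  ext (p | i)
  · simp [Port.twin_eq_self_iff]
  · simp

theorem ncard_range_inr {γ : Type*} : (Set.range (Sum.inr : Fin d → γ ⊕ Fin d)).ncard = d := by
  rw [← Set.image_univ, Set.ncard_image_of_injective _ Sum.inr_injective, Set.ncard_univ,
    Nat.card_eq_fintype_card, Fintype.card_fin]

theorem ncard_auxPerm_eq_self (hB : B.IsFinite) (hX : X ⊆ B.graph.vertexSet) :
    {a | auxPerm B X d a = a}.ncard = X.ncard + d := by
  have := Port.finite (X := X) hB
  rw [setOf_auxPerm_eq_self, Set.ncard_union_eq, Set.ncard_image_of_injective _ Sum.inl_injective,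
    Port.ncard_vertex_mem hX, ncard_range_inr]
  rw [Set.disjoint_left]
  rintro _ ⟨p, -, rfl⟩ ⟨i, h⟩
  cases h

/-! ### Perfect matchings and Tutte violators of the auxiliary graph -/

/-- The alternating sequences that avoid the additional vertices are the port sequences of disjoint
`X`-paths. -/
theorem hasDisjointXPaths_of_isPerfectMatching (hB : B.IsFinite) (hX : X ⊆ B.graph.vertexSet)
    (hd : X.ncard = d + 2 * k) {M : (auxGraph B X d).Subgraph} (hM : M.IsPerfectMatching) :
    B.HasDisjointXPaths X k := by
  have := Port.finite (X := X) hB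
  rw [SimpleGraph.Subgraph.isPerfectMatching_iff] at hM
  choose m hmM hmu using hM
  have hm (a) : m (m a) = a := (hmu (m a) a (hmM a).symm).symm
  have hmadj (a) : (auxGraph B X d).Adj a (m a) := (hmM a).adj_sub
  obtain ⟨n, a, ha, hdisj⟩ := exists_disjoint_alternating_sequences (τ := auxPerm B X d)
    (m := Function.Involutive.toPerm m hm) auxPerm_auxPerm hm (fun a => (hmadj a).ne')
    (Set.range Sum.inr) k (by rw [ncard_auxPerm_eq_self hB hX, ncard_range_inr]; omega)
  have key (i : Fin k) : ∃ P : B.Path, P.IsXPath X ∧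
      ∀ v ∈ P.verts, ∃ (t : ℕ) (p : B.Port X), a i t = .inl p ∧ p.vertex = v := by
    obtain ⟨hn, ⟨h0, h0D⟩, ⟨h1, h1D⟩, hint, hmτ, hne⟩ := ha i
    have hp (t : Fin (n i + 1)) : ∃ p : B.Port X, a i t = .inl p := by
      rcases hat : a i t with p | j
      · exact ⟨p, rfl⟩
      · rcases Nat.eq_zero_or_pos (t : ℕ) with ht | ht
        · exact absurd ⟨j, by rw [← hat, ht]⟩ h0D
        · rcases (Nat.lt_succ_iff.1 t.2).lt_or_eq with htn | htn
          · exact absurd (by rw [hat]; rfl) (hint t ht htn)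
          · exact absurd ⟨j, by rw [← hat, htn]⟩ h1D
    choose p hp using hp
    have hfix (t : Fin (n i + 1)) : (p t).vertex ∈ X ↔ auxPerm B X d (a i t) = a i t := by
      rw [hp, auxPerm_inl, Sum.inl.injEq, Port.twin_eq_self_iff]
    have hne' (s t : Fin (n i + 1)) (hst : s < t) : (p s).vertex ≠ (p t).vertex := by
      intro h
      obtain ⟨hst1, hst2⟩ := hne s t hst (by omega)
      rw [hp, hp] at hst1 hst2
      rcases Port.eq_or_eq_twin h with h | h
      · exact hst1 (congrArg _ h)
      · exact hst2 (congrArg _ h)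
    obtain ⟨P, hP, hPv⟩ := exists_isXPath_of_ports p
      (fun s t h => by
        rcases lt_trichotomy s t with hst | hst | hst
        · exact absurd h (hne' s t hst)
        · exact hst
        · exact absurd h.symm (hne' t s hst))
      (fun t => by
        have h2 := hmadj (a i t)
        have h3 : m (a i t) = _ := hmτ t
        have h4 := hp t.castSucc
        have h5 := hp t.succ
        rw [Fin.val_castSucc] at h4
        rw [Fin.val_succ] at h5
        rw [h3, h4, h5, auxPerm_inl, auxGraph_adj_inl] at h2
        refine h2.2.resolve_right fun h6 => hne' t.castSucc t.succ Fin.castSucc_lt_succ ?_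
        rw [← Port.vertex_twin (p t.succ), h6, Port.vertex_twin])
      hn ((hfix 0).2 h0) ((hfix _).2 h1)
      (fun t ht htn h => hint t (Nat.pos_of_ne_zero fun h' => ht (Fin.ext h'))
        (lt_of_le_of_ne (Nat.lt_succ_iff.1 t.2) fun h' => htn (Fin.ext h')) ((hfix t).1 h))
    refine ⟨P, hP, ?_⟩
    rw [hPv]
    rintro _ ⟨t, rfl⟩
    exact ⟨t, p t, hp t, rfl⟩
  choose P hP hPv using key
  refine ⟨P, hP, fun i j hij => Set.disjoint_left.2 fun v hvi hvj => ?_⟩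
  obtain ⟨s, p, hs, rfl⟩ := hPv i v hvi
  obtain ⟨t, q, ht, hq⟩ := hPv j _ hvj
  obtain ⟨h1, h2⟩ := hdisj i j hij s t
  rw [hs, ht] at h1 h2
  rcases Port.eq_or_eq_twin hq.symm with h | h
  · exact h1 (congrArg _ h)
  · exact h2 (congrArg _ h)

/-- A Tutte violator contains all `d` additional vertices, since they are adjacent to everything
and at least two components remain. They are therefore contained in the hitting set for
alternating sequences as well, and only the other members of that set count for `Y`. -/
theorem exists_hitting_set_of_isTutteViolator (hB : B.IsFinite) (hX : X ⊆ B.graph.vertexSet)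
    (hd : X.ncard = d + 2 * k) {U : Set (B.Port X ⊕ Fin d)}
    (hU : (auxGraph B X d).IsTutteViolator U) :
    ∃ Y : Finset α, (Y : Set α) ⊆ B.graph.vertexSet ∧ Y.card + 2 ≤ 2 * k ∧
      ¬ (B.deleteVerts Y).HasXPath X := by
  classical
  have := Port.finite (X := X) hB
  have hF := ncard_auxPerm_eq_self (d := d) hB hX
  -- The number of vertices of the auxiliary graph is even, which improves the bound by one.
  have hW : Even (Nat.card (B.Port X ⊕ Fin d)) := by
    have h1 : Even ({a : B.Port X ⊕ Fin d | auxPerm B X d a = a}ᶜ).ncard := by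
      refine even_ncard_of_involution (Set.toFinite _) auxPerm_auxPerm (fun a ha => ha)
        fun a ha => ?_
      intro h
      exact ha ((auxPerm B X d).injective h)
    have h2 := Set.ncard_add_ncard_compl {a : B.Port X ⊕ Fin d | auxPerm B X d a = a}
    rw [← h2, hF, hd]
    refine Even.add ⟨d + k, by omega⟩ h1
  have hU2 : U.ncard + 2 ≤
      ((⊤ : (auxGraph B X d).Subgraph).deleteVerts U).coe.oddComponents.ncard := by
    have h1 := SimpleGraph.odd_ncard_oddComponents
      ((⊤ : (auxGraph B X d).Subgraph).deleteVerts U).coe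
    have h2 : Nat.card ((⊤ : (auxGraph B X d).Subgraph).deleteVerts U).verts = Uᶜ.ncard := by
      rw [Nat.card_coe_set_eq]
      congr 1
      ext a
      simp
    have h3 := Set.ncard_add_ncard_compl U
    rw [h2] at h1
    unfold SimpleGraph.IsTutteViolator at hU
    rw [Nat.odd_iff, Nat.odd_iff] at h1
    rw [Nat.even_iff] at hW
    omega
  have hDU : Set.range Sum.inr ⊆ U := by
    rintro _ ⟨i, rfl⟩
    by_contra hi
    have hv : Sum.inr i ∈ ((⊤ : (auxGraph B X d).Subgraph).deleteVerts U).verts := by simpa using hi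
    have h1 (x) : ((⊤ : (auxGraph B X d).Subgraph).deleteVerts U).coe.Reachable x
        ⟨Sum.inr i, hv⟩ := by
      by_cases hx : x = ⟨Sum.inr i, hv⟩
      · rw [hx]
      · refine SimpleGraph.Adj.reachable ?_
        have hxi : x.1 ≠ Sum.inr i := fun h => hx (Subtype.ext h)
        have hxU : x.1 ∉ U := by simpa using x.2
        simp [hi, hxU, auxGraph_adj_inr hxi]
    have h2 : ((⊤ : (auxGraph B X d).Subgraph).deleteVerts U).coe.oddComponents.ncard ≤ 1 := by
      refine (Set.ncard_le_one_iff (Set.toFinite _)).2 fun {C C'} _ _ => ?_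
      induction C using SimpleGraph.ConnectedComponent.ind with | _ x
      induction C' using SimpleGraph.ConnectedComponent.ind with | _ y
      exact SimpleGraph.ConnectedComponent.sound ((h1 x).trans (h1 y).symm)
    omega
  obtain ⟨Z, hZc, hUZ, hZ⟩ := exists_hitting_set auxPerm_auxPerm (fun a => auxGraph_adj_auxPerm) U hU2
  have hDZ : Set.range Sum.inr ⊆ Z := by
    rintro _ ⟨i, rfl⟩
    exact hUZ _ (hDU ⟨i, rfl⟩) (hDU ⟨i, rfl⟩)
  set Y : Set α := Port.vertex '' (Sum.inl ⁻¹' Z : Set (B.Port X)) with hY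
  have hYfin : Y.Finite := (Set.toFinite _).image _
  have hYc : Y.ncard + d ≤ Z.ncard := by
    have h1 : Y.ncard ≤ (Sum.inl '' (Sum.inl ⁻¹' Z : Set (B.Port X)) : Set (_ ⊕ Fin d)).ncard := by
      rw [Set.ncard_image_of_injective _ Sum.inl_injective]
      exact Set.ncard_image_le (Set.toFinite _)
    have h2 : Disjoint (Sum.inl '' (Sum.inl ⁻¹' Z : Set (B.Port X)) : Set (_ ⊕ Fin d))
        (Set.range Sum.inr) := by
      rw [Set.disjoint_left]
      rintro _ ⟨p, -, rfl⟩ ⟨i, h⟩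
      cases h
    have h3 := Set.ncard_le_ncard (Set.union_subset (Set.image_preimage_subset Sum.inl Z) hDZ)
    rw [Set.ncard_union_eq h2, ncard_range_inr] at h3
    omega
  have hFU : ({a | auxPerm B X d a = a} \ U).ncard + d ≤ X.ncard + d := by
    rw [← hF]
    have h1 : Disjoint ({a | auxPerm B X d a = a} \ U) (Set.range Sum.inr) :=
      Set.disjoint_left.2 fun a ha haD => ha.2 (hDU haD)
    have h2 := Set.ncard_union_eq h1
    rw [ncard_range_inr] at h2
    rw [← h2]
    refine Set.ncard_le_ncard (Set.union_subset Set.sdiff_subset ?_)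
    rintro _ ⟨i, rfl⟩
    rfl
  refine ⟨hYfin.toFinset, ?_, ?_, fun hpath => ?_⟩
  · rw [Set.Finite.coe_toFinset]
    rintro _ ⟨p, -, rfl⟩
    exact p.vertex_mem
  · rw [← Set.ncard_eq_toFinset_card Y hYfin]
    omega
  · obtain ⟨P, hP, hPY⟩ := exists_isXPath_disjoint_of_deleteVerts hpath
    rw [Set.Finite.coe_toFinset] at hPY
    obtain ⟨p, hpv, hpl⟩ := hP.exists_ports
    have hfix (i) (h : P.vert i ∈ X) : auxPerm B X d (.inl (p i)) = .inl (p i) := by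
      rw [auxPerm_inl, Port.twin_eq_self_iff.2 (by rwa [hpv])]
    have hpne (i j) (h : i ≠ j) : (p i).vertex ≠ (p j).vertex := by
      rw [hpv, hpv]
      exact fun h' => h (P.vert_injective h')
    -- `min` extends the sequence of ports to all indices; only those up to the length matter
    obtain ⟨i, hi, hiZ⟩ := hZ P.length
      (fun t => .inl (p ⟨min t P.length, by omega⟩)) (hfix _ (by simpa using hP.2.1))
      (hfix _ (by simpa [Fin.last] using hP.2.2.1)) hP.1
      (fun i hi => by
        have h1 := hpl ⟨i, hi⟩
        have h2 : (⟨min i P.length, by omega⟩ : Fin (P.length + 1)) = Fin.castSucc ⟨i, hi⟩ :=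
          Fin.ext (by simp; omega)
        have h3 : (⟨min (i + 1) P.length, by omega⟩ : Fin (P.length + 1)) = Fin.succ ⟨i, hi⟩ :=
          Fin.ext (by simp; omega)
        rw [h2, h3, auxPerm_inl, auxGraph_adj_inl]
        exact ⟨fun h => hpne _ _ Fin.castSucc_lt_succ.ne (by rw [h, Port.vertex_twin]), .inl h1⟩)
      (fun i hi j hj => by
        rw [auxPerm_inl, ne_eq, Sum.inl.injEq]
        intro h
        refine hpne ⟨min (i + 1) P.length, by omega⟩ ⟨min j P.length, by omega⟩ ?_ ?_
        · rw [ne_eq, Fin.mk.injEq]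
          omega
        · rw [← h, Port.vertex_twin])
    refine Set.disjoint_left.1 hPY ⟨_, (hpv ⟨min i P.length, by omega⟩).symm⟩ ?_
    rcases hiZ with h | h
    · exact ⟨_, h, rfl⟩
    · exact ⟨_, h, rfl⟩

/-- If `X` has fewer than `2 * k` vertices, all but one of them can be deleted. -/
theorem exists_hitting_set_of_ncard_lt (hB : B.IsFinite) (hX : X ⊆ B.graph.vertexSet)
    (hk : X.ncard < 2 * k) :
    ∃ Y : Finset α, (Y : Set α) ⊆ B.graph.vertexSet ∧ Y.card + 2 ≤ 2 * k ∧
      ¬ (B.deleteVerts Y).HasXPath X := by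
  classical
  have hXfin : X.Finite := hB.1.subset hX
  rcases X.eq_empty_or_nonempty with rfl | ⟨x, hx⟩
  · refine ⟨∅, by simp, by simp at hk ⊢; omega, fun ⟨P, hP⟩ => hP.2.1⟩
  · refine ⟨hXfin.toFinset.erase x, ?_, ?_, fun h => ?_⟩
    · intro y hy
      simp only [Finset.coe_erase, Set.Finite.coe_toFinset] at hy
      exact hX hy.1
    · rw [Finset.card_erase_of_mem (by simpa using hx), ← Set.ncard_eq_toFinset_card X hXfin]
      omega
    · obtain ⟨P, hP, hPY⟩ := exists_isXPath_disjoint_of_deleteVerts h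
      have hall (i) (hi : P.vert i ∈ X) : P.vert i = x := by
        by_contra hne
        exact Set.disjoint_left.1 hPY ⟨i, rfl⟩ (by simp [hne, hi])
      exact hP.vert_zero_ne_vert_last ((hall _ hP.2.1).trans (hall _ hP.2.2.1).symm)

end BidirectedMultigraph

theorem theorem4p1 (k : ℕ) :
    (∀ (α : Type*) (β : Type*) (B : BidirectedMultigraph α β) (X : Set α),
      B.IsFinite → X ⊆ B.graph.vertexSet →
        B.HasDisjointXPaths X k ∨
          ∃ Y : Finset α, (Y : Set α) ⊆ B.graph.vertexSet ∧ (Y.card : ℤ) ≤ 2 * (k : ℤ) - 2 ∧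
            ¬ (B.deleteVerts Y).HasXPath X) ∧
    (1 ≤ k →
      ∃ (α : Type) (β : Type) (B : BidirectedMultigraph α β) (X : Set α),
        B.IsFinite ∧ B.graph.Simple ∧ X ⊆ B.graph.vertexSet ∧
        ¬ B.HasDisjointXPaths X k ∧
        ¬ ∃ Y : Finset α, (Y : Set α) ⊆ B.graph.vertexSet ∧ (Y.card : ℤ) < 2 * (k : ℤ) - 2 ∧
            ¬ (B.deleteVerts Y).HasXPath X) := by
  refine ⟨fun α β B X hB hX => or_iff_not_imp_left.2 fun hpaths => ?_,
    BidirectedMultigraph.exists_tight_example⟩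
  suffices ∃ Y : Finset α, (Y : Set α) ⊆ B.graph.vertexSet ∧ Y.card + 2 ≤ 2 * k ∧
      ¬ (B.deleteVerts Y).HasXPath X by
    obtain ⟨Y, hYV, hYk, hY⟩ := this
    exact ⟨Y, hYV, by omega, hY⟩
  rcases lt_or_ge X.ncard (2 * k) with hk | hk
  · exact BidirectedMultigraph.exists_hitting_set_of_ncard_lt hB hX hk
  have hd : X.ncard = (X.ncard - 2 * k) + 2 * k := by omega
  have := BidirectedMultigraph.Port.finite (X := X) hB
  by_contra hY
  have htutte : ∀ U, ¬ (B.auxGraph X (X.ncard - 2 * k)).IsTutteViolator U := fun U hU =>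
    hY (BidirectedMultigraph.exists_hitting_set_of_isTutteViolator hB hX hd hU)
  obtain ⟨M, hM⟩ := SimpleGraph.tutte.2 htutte
  exact hpaths (BidirectedMultigraph.hasDisjointXPaths_of_isPerfectMatching hB hX hd hM)
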